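/- **Setting.** For $k\ge 0$ let $P_k$ be the Legendre polynomial on $[-1,1]$, and let $\psi_k=\sqrt{2k+1}\,P_k$, which is normalized with respect to $\frac12 dx$. Let $n\ge 2$ and $p\ge 1$ be integers. Let $\Lambda$ be the set of multi-indices $\alpha\in\mathbb{N}^n$ with $|\alpha|=\alpha_1+\dots+\alpha_n\le p$; it has $N=\binom{n+p}{p}$ elements. For $u\in\mathbb{R}^n$, the *cyclic Legendre sampling matrix of order $p$* generated by $u$ is the matrix $A\in\mathbb{R}^{n\times N}$ with entries $$A_{i,\alpha}=\prod_{j=1}^{n}\psi_{\alpha_j}(u_{i+j-1}),\qquad 1\le i\le n,\ \alpha\in\Lambda,$$ where the indices of $u$ are taken cyclically modulo $n$. The matrix generated by $K$ vectors $u(1),\dots,u(K)\in\mathbb{R}^n$ is the $Kn\times N$ matrix obtained by stacking the $K$ corresponding matrices row-wise. For a real $m\times N$ matrix $A$, a vector $v\in\mathbb{C}^m$ and a number $\sigma$, the problem L-BP$_\sigma$ is to minimize $\|c'\|_1$ over all $c'\in\mathbb{C}^N$ with $\|Ac'-v\|_2\le\sigma$. A vector is $s$-sparse if it has at most $s$ nonzero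 entries. **Theorem.** There is a universal constant $d>0$ (independent of all other quantities) such that the following holds for all integers $n\ge2$ and $p\ge1$. 1. Let $A$ be the cyclic Legendre sampling matrix of order $p$ generated by a random vector $u\in\mathbb{R}^n$ with i.i.d. entries uniformly distributed in $[-1,1]$. Then there is an event of probability exceeding $$1-\left(\frac{e}{p}+\frac{e}{2p^2}\right)^{2p}n^{-2p/11}$$ on which, for every integer $s\ge 0$ with $$\frac{n}{\log n}\ \ge\ 144\,p^6\,9^p\,s^2,$$ every $s$-sparse $c\in\mathbb{C}^N$ and all $v,e\in\mathbb{C}^n$ and $\sigma$ with $v=Ac+e$ and $\|e\|_2\le\sigma$: the problem L-BP$_\sigma$ has a solution, and every solution $c^\#$ satisfies $$\|c-c^\#\|_1\le d\,s\,\sigma .$$ 2. Let $K\ge 0$ be an integer and let $A$ be generated by $K$ random vectors $u(1),\dots,u(K)\in\mathbb{R}^n$ whose $Kn$ entries are i.i.d. and uniformly distributed in $[-1,1]$. Then there is an event of probability exceeding the same bound $1-\left(\frac{e}{p}+\frac{e}{2p^2}\right)^{2p}n^{-2p/11}$ on which, for every integer $s\ge 0$ with $$K\ \ge\ \frac{144\,p^6\,9^p\,s^2\,\log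 n}{n},$$ every $s$-sparse $c\in\mathbb{C}^N$ and all $v,e\in\mathbb{C}^{Kn}$ and $\sigma$ with $v=Ac+e$ and $\|e\|_2\le\sigma$: the problem L-BP$_\sigma$ has a solution, and every solution $c^\#$ satisfies $\|c-c^\#\|_1\le d\,s\,\sigma$. -/

import Mathlib

open MeasureTheory ProbabilityTheory

noncomputable section

namespace CyclicLegendre

/-- The univariate Legendre polynomial `P_k` on `[-1,1]`, by Rodrigues' formula
`P_k = 1 / (2^k k!) * (d/dx)^k (x^2 - 1)^k`. -/
def legendrePoly (k : ℕ) : Polynomial ℝ :=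
  Polynomial.C (1 / ((2 : ℝ) ^ k * (k.factorial : ℝ))) *
    (Polynomial.derivative^[k] ((Polynomial.X ^ 2 - 1) ^ k))

/-- The Legendre polynomial normalized in `L^2([-1,1], dx/2)`: `√(2k+1) * P_k(x)`. -/
def normLegendre (k : ℕ) (x : ℝ) : ℝ :=
  Real.sqrt (2 * (k : ℝ) + 1) * (legendrePoly k).eval x

/-- Multi-indices in `n` variables of total degree at most `p`; they index the
`N = (n+p).choose p` columns of the sampling matrix. -/
abbrev MultiIdx (n p : ℕ) : Type :=
  {α : Fin n → Fin (p + 1) // ∑ j, (α j : ℕ) ≤ p}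

/-- The tensorized Legendre basis function with multi-index `α`. -/
def tensorLegendre {n p : ℕ} (α : MultiIdx n p) (x : Fin n → ℝ) : ℝ :=
  ∏ j, normLegendre (α.1 j : ℕ) (x j)

/-- The cyclic Legendre sampling matrix of order `p` generated by one vector `u`: row `i` is the
basis evaluated at the shifted vector `(u_i, u_{i+1}, …, u_{i+n-1})`.
Addition in `Fin n` is modulo `n`. -/
def samplingMatrix {n : ℕ} (p : ℕ) (u : Fin n → ℝ) : Matrix (Fin n) (MultiIdx n p) ℝ :=
  Matrix.of fun i α => tensorLegendre α (fun j => u (i + j))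

/-- The sampling matrix generated by `K` vectors `u(1), …, u(K)`: the `K` cyclic sampling matrices
stacked row-wise; row `(k, i)` is row `i` of the matrix of `u(k)`. -/
def multiSamplingMatrix {K n : ℕ} (p : ℕ) (u : Fin K → Fin n → ℝ) :
    Matrix (Fin K × Fin n) (MultiIdx n p) ℝ :=
  Matrix.of fun r α => samplingMatrix p (u r.1) r.2 α

section Recovery

variable {ι κ : Type*} [Fintype ι] [Fintype κ]

/-- The `ℓ^1` norm on `ℂ^κ`. -/
def l1Norm (c : κ → ℂ) : ℝ := ∑ j, ‖c j‖

/-- The `ℓ^2` norm on `ℂ^ι`. -/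
def l2Norm (x : ι → ℂ) : ℝ := Real.sqrt (∑ i, ‖x i‖ ^ 2)

/-- The vector `c` has at most `s` nonzero entries. -/
def IsSparse (s : ℕ) (c : κ → ℂ) : Prop := {j | c j ≠ 0}.ncard ≤ s

/-- A real matrix acting on complex vectors. -/
def applyMat (A : Matrix ι κ ℝ) (c : κ → ℂ) : ι → ℂ :=
  (A.map (fun a : ℝ => (a : ℂ))).mulVec c

/-- The feasible set of the basis pursuit problem with data `v` and noise level `σ`. -/
def bpFeasible (A : Matrix ι κ ℝ) (v : ι → ℂ) (σ : ℝ) : Set (κ → ℂ) :=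
  {z | l2Norm (applyMat A z - v) ≤ σ}

/-- `z` is a solution of basis pursuit: minimize `‖z‖_1` subject to `‖A z - v‖_2 ≤ σ`. -/
def IsBPSolution (A : Matrix ι κ ℝ) (v : ι → ℂ) (σ : ℝ) (z : κ → ℂ) : Prop :=
  z ∈ bpFeasible A v σ ∧ ∀ z' ∈ bpFeasible A v σ, l1Norm z ≤ l1Norm z'

/-- Every `s`-sparse `c` with `v = A c + e` and `‖e‖_2 ≤ σ` is recovered by basis pursuit with
`ℓ^1` error at most `d * s * σ`: the problem has a solution, and every solution obeys the bound. -/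
def StableSparseRecovery (A : Matrix ι κ ℝ) (s : ℕ) (d : ℝ) : Prop :=
  ∀ (c : κ → ℂ) (v e : ι → ℂ) (σ : ℝ), IsSparse s c → v = applyMat A c + e → l2Norm e ≤ σ →
    (∃ z, IsBPSolution A v σ z) ∧
      ∀ z, IsBPSolution A v σ z → l1Norm (c - z) ≤ d * (s : ℝ) * σ

end Recovery

/-- The bound `1 - (e/p + e/(2p^2))^(2p) * n^(-2p/11)` that the success probability exceeds. -/
def probBound (n p : ℕ) : ℝ :=
  1 - (Real.exp 1 / (p : ℝ) + Real.exp 1 / (2 * (p : ℝ) ^ 2)) ^ (2 * p) *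
    (n : ℝ) ^ (-(2 * (p : ℝ) / 11))

end CyclicLegendre

end

/-!
# Sparse recovery from cyclic Legendre sampling matrices

Let `A` be the sampling matrix of `K` vectors and `M = K n` its number of rows. Recovery needs only
that `Aᵀ A` is entrywise within `M t` of `M` times the identity, diagonal included, with `s t` below
one half. For such `A` every vector satisfies `|h_a| ≤ t ‖h‖₁ + √(1 + t) ‖A h‖₂`
(`norm_apply_le_of_gramDeviationLE`). When `h = c - z` is the error of a basis pursuit solution `z`,
at least half of `‖h‖₁` sits on the support of `c`, so summing over that support bounds `‖h‖₁` by a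
constant times `s σ` (`stableSparseRecovery_of_gramDeviationLE`).

The rows of `A` are identically distributed and the tensorized Legendre polynomials are orthonormal
(`integral_tensorLegendre_mul`), so `Aᵀ A` has mean `M` times the identity. An entry of `Aᵀ A` is a
function of `M` independent samples. Since a multi-index has at most `p` active variables, one
sample enters at most `2 p` of the `M` summands, and each summand is at most `3^p` in absolute value
because `|P_k| ≤ 1` on `[-1, 1]` (`abs_legendrePoly_eval_le_one`). The dependence between the rows
is thus harmless for McDiarmid's inequality
(`hasSubgaussianMGF_of_iIndepFun_of_bounded_differences`), which bounds the probability that an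
entry deviates by `M t` by `2 exp (-M t² / (8 p² 9^p))`.

Choosing `t² = 32 p^6 9^p log n / M` makes this `2 n^(-4 p^4)`, small enough for a union bound over
all pairs of columns (`card_sq_mul_exp_lt`), while an admissible sparsity has `s t ≤ √2 / 3 < 1/2`.
The radius `t` does not involve `s`, so one event serves all sparsities. A single vector is the case
`K = 1`.
-/

/-! ### Basis pursuit under a bound on the Gram matrix -/

namespace CyclicLegendre

section Recovery

variable {ι κ : Type*} [Fintype ι] [Fintype κ]

/-- The entries of `Aᵀ A` differ by at most `M t` from those of `M` times the identity, where `M`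
is the number of rows of `A`. Diagonal entries are included, so the columns of `A` need not be
normalized. -/
def GramDeviationLE [DecidableEq κ] (A : Matrix ι κ ℝ) (t : ℝ) : Prop :=
  ∀ a b, |∑ i, A i a * A i b - if a = b then (Fintype.card ι : ℝ) else 0| ≤ Fintype.card ι * t

lemma l2Norm_eq_norm (x : ι → ℂ) : l2Norm x = ‖WithLp.toLp 2 x‖ := by
  rw [l2Norm, EuclideanSpace.norm_eq]

lemma l2Norm_nonneg (x : ι → ℂ) : 0 ≤ l2Norm x := Real.sqrt_nonneg _

lemma l2Norm_sub_le (x y : ι → ℂ) : l2Norm (x - y) ≤ l2Norm x + l2Norm y := by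
  simp only [l2Norm_eq_norm, WithLp.toLp_sub]
  exact norm_sub_le _ _

lemma l2Norm_neg (x : ι → ℂ) : l2Norm (-x) = l2Norm x := by
  simp [l2Norm]

omit [Fintype ι] in
lemma applyMat_apply (A : Matrix ι κ ℝ) (c : κ → ℂ) (i : ι) :
    applyMat A c i = ∑ j, (A i j : ℂ) * c j := by
  simp [applyMat, Matrix.mulVec, dotProduct]

omit [Fintype ι] in
lemma applyMat_sub (A : Matrix ι κ ℝ) (c z : κ → ℂ) :
    applyMat A (c - z) = applyMat A c - applyMat A z := by
  simp [applyMat, Matrix.mulVec_sub]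

lemma continuous_l1Norm : Continuous (l1Norm : (κ → ℂ) → ℝ) := by
  unfold l1Norm; fun_prop

lemma continuous_l2Norm : Continuous (l2Norm : (ι → ℂ) → ℝ) := by
  unfold l2Norm; fun_prop

omit [Fintype ι] in
lemma continuous_applyMat (A : Matrix ι κ ℝ) : Continuous (applyMat A) := by
  refine continuous_pi fun i => ?_
  simp only [applyMat_apply]
  fun_prop

lemma norm_le_l1Norm (c : κ → ℂ) : ‖c‖ ≤ l1Norm c := by
  refine (pi_norm_le_iff_of_nonneg (Finset.sum_nonneg fun _ _ => norm_nonneg _)).2 fun j => ?_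
  exact Finset.single_le_sum (f := fun j => ‖c j‖) (fun _ _ => norm_nonneg _) (Finset.mem_univ j)

/-- A feasible basis pursuit problem has a solution: the feasible set is closed and the `ℓ^1` norm
is coercive. -/
lemma exists_isBPSolution (A : Matrix ι κ ℝ) (v : ι → ℂ) (σ : ℝ) {c : κ → ℂ}
    (hc : c ∈ bpFeasible A v σ) : ∃ z, IsBPSolution A v σ z := by
  have hclosed : IsClosed (bpFeasible A v σ) :=
    isClosed_le (continuous_l2Norm.comp ((continuous_applyMat A).sub continuous_const))
      continuous_const
  have hco : ∀ᶠ z in Filter.cocompact (κ → ℂ) ⊓ Filter.principal (bpFeasible A v σ),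
      l1Norm c ≤ l1Norm z := by
    refine Filter.Eventually.filter_mono inf_le_left ?_
    filter_upwards [(tendsto_norm_cocompact_atTop (E := κ → ℂ)).eventually_ge_atTop (l1Norm c)]
      with z hz using hz.trans (norm_le_l1Norm z)
  obtain ⟨z, hz, hmin⟩ := continuous_l1Norm.continuousOn.exists_isMinOn' hclosed hc hco
  exact ⟨z, hz, fun z' hz' => hmin hz'⟩

/-- Each entry of `h` is controlled by `t ‖h‖_1` and `‖A h‖_2`: compare `h` with `M⁻¹ Aᵀ A h`. -/
lemma norm_apply_le_of_gramDeviationLE [DecidableEq κ] [Nonempty ι] {A : Matrix ι κ ℝ} {t : ℝ}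
    (hA : GramDeviationLE A t) (h : κ → ℂ) (a : κ) :
    ‖h a‖ ≤ t * l1Norm h + Real.sqrt (1 + t) * l2Norm (applyMat A h) := by
  set M : ℝ := (Fintype.card ι : ℝ) with hM
  have hM1 : 1 ≤ M := by
    rw [hM]; exact_mod_cast Fintype.card_pos
  have key : (M : ℂ) * h a = ∑ i, (A i a : ℂ) * applyMat A h i -
      ∑ b, ((∑ i, A i a * A i b - if a = b then M else 0 : ℝ) : ℂ) * h b := by
    have h1 : ∑ i, (A i a : ℂ) * applyMat A h i = ∑ b, ((∑ i, A i a * A i b : ℝ) : ℂ) * h b := by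
      simp only [applyMat_apply, Finset.mul_sum, Complex.ofReal_sum, Finset.sum_mul]
      rw [Finset.sum_comm]
      refine Finset.sum_congr rfl fun b _ => Finset.sum_congr rfl fun i _ => ?_
      push_cast; ring
    rw [h1, ← Finset.sum_sub_distrib]
    simp only [← sub_mul, ← Complex.ofReal_sub, sub_sub_cancel]
    rw [Finset.sum_eq_single a (fun b _ hb => by simp [hb.symm]) (by simp)]
    simp
  have hcol : ∑ i, |A i a| ^ 2 ≤ M * (1 + t) := by
    have := (abs_le.1 (hA a a)).2
    simp only [if_true] at this
    have h2 : ∑ i, |A i a| ^ 2 = ∑ i, A i a * A i a :=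
      Finset.sum_congr rfl fun i _ => by rw [sq_abs, sq]
    rw [h2]; linarith
  have hfirst : ‖∑ i, (A i a : ℂ) * applyMat A h i‖
      ≤ Real.sqrt (M * (1 + t)) * l2Norm (applyMat A h) := by
    calc ‖∑ i, (A i a : ℂ) * applyMat A h i‖ ≤ ∑ i, |A i a| * ‖applyMat A h i‖ := by
          refine (norm_sum_le _ _).trans_eq (Finset.sum_congr rfl fun i _ => ?_)
          rw [norm_mul, Complex.norm_real, Real.norm_eq_abs]
      _ ≤ Real.sqrt (∑ i, |A i a| ^ 2) * Real.sqrt (∑ i, ‖applyMat A h i‖ ^ 2) :=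
          Real.sum_mul_le_sqrt_mul_sqrt _ _ _
      _ ≤ _ := mul_le_mul_of_nonneg_right (Real.sqrt_le_sqrt hcol) (Real.sqrt_nonneg _)
  have hsecond : ‖∑ b, ((∑ i, A i a * A i b - if a = b then M else 0 : ℝ) : ℂ) * h b‖
      ≤ M * t * l1Norm h := by
    rw [l1Norm, Finset.mul_sum]
    refine (norm_sum_le _ _).trans (Finset.sum_le_sum fun b _ => ?_)
    rw [norm_mul, Complex.norm_real, Real.norm_eq_abs]
    exact mul_le_mul_of_nonneg_right (hA a b) (norm_nonneg _)
  have hsum : M * ‖h a‖ ≤ M * (t * l1Norm h + Real.sqrt (1 + t) * l2Norm (applyMat A h)) := by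
    have h3 : M * ‖h a‖ = ‖(M : ℂ) * h a‖ := by
      rw [norm_mul, Complex.norm_real, Real.norm_eq_abs, abs_of_pos (by linarith)]
    have h4 : Real.sqrt (M * (1 + t)) ≤ M * Real.sqrt (1 + t) := by
      rw [Real.sqrt_mul (by linarith)]
      exact mul_le_mul_of_nonneg_right (Real.sqrt_le_iff.2 ⟨by linarith, by nlinarith⟩)
        (Real.sqrt_nonneg _)
    rw [h3, key]
    have := mul_le_mul_of_nonneg_right h4 (l2Norm_nonneg (applyMat A h))
    linarith [norm_sub_le (∑ i, (A i a : ℂ) * applyMat A h i)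
      (∑ b, ((∑ i, A i a * A i b - if a = b then M else 0 : ℝ) : ℂ) * h b)]
  exact le_of_mul_le_mul_left hsum (by linarith)

/-- If `z` has `ℓ^1` norm at most that of `c`, at least half of the `ℓ^1` norm of `c - z` sits on
any set containing the support of `c`. -/
lemma l1Norm_sub_le_of_l1Norm_le {c z : κ → ℂ} {S : Finset κ} (hS : ∀ j ∉ S, c j = 0)
    (hz : l1Norm z ≤ l1Norm c) : l1Norm (c - z) ≤ 2 * ∑ j ∈ S, ‖(c - z) j‖ := by
  classical
  have hpt : ∀ j, ‖c j‖ + ‖(c - z) j‖ ≤ ‖z j‖ + 2 * if j ∈ S then ‖(c - z) j‖ else 0 := by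
    intro j
    by_cases hj : j ∈ S
    · have : ‖c j‖ ≤ ‖z j‖ + ‖(c - z) j‖ := by
        simpa using norm_add_le (z j) ((c - z) j)
      simp only [hj, if_true]; linarith
    · simp [hj, hS j hj]
  have := Finset.sum_le_sum fun j (_ : j ∈ Finset.univ) => hpt j
  rw [Finset.sum_add_distrib, Finset.sum_add_distrib, ← Finset.mul_sum, Finset.sum_ite_mem,
    Finset.univ_inter] at this
  simp only [l1Norm] at hz ⊢
  linarith

/-- A matrix whose Gram matrix is entrywise close to a multiple of the identity, up to a constant
less than one half over `s`, recovers `s`-sparse vectors stably. For `s = 0` the matrix may have no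
rows. -/
theorem stableSparseRecovery_of_gramDeviationLE [DecidableEq κ] {A : Matrix ι κ ℝ}
    {t : ℝ} {s : ℕ} (hι : 0 < s → Nonempty ι) (hA : GramDeviationLE A t) (hst : s * t ≤ 12 / 25) :
    StableSparseRecovery A s 125 := by
  intro c v e σ hc hv he
  have hfeas : c ∈ bpFeasible A v σ := by
    simp only [bpFeasible, Set.mem_ofPred_eq, hv, sub_add_cancel_left, l2Norm_neg, he]
  refine ⟨exists_isBPSolution A v σ hfeas, fun z hz => ?_⟩
  set S : Finset κ := Finset.univ.filter fun j => c j ≠ 0 with hS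
  have hcard : (S.card : ℝ) ≤ s := by
    have : S.card ≤ s := by
      rw [← Set.ncard_coe_finset, hS, Finset.coe_filter]
      simpa [IsSparse] using hc
    exact_mod_cast this
  have hcone := l1Norm_sub_le_of_l1Norm_le (S := S) (by simp [hS]) (hz.2 c hfeas)
  have hres : l2Norm (applyMat A (c - z)) ≤ 2 * σ := by
    have : applyMat A (c - z) = (applyMat A c - v) - (applyMat A z - v) := by
      rw [applyMat_sub]; abel
    rw [this]
    have h1 : l2Norm (applyMat A c - v) ≤ σ := hfeas
    have h2 : l2Norm (applyMat A z - v) ≤ σ := hz.1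
    linarith [l2Norm_sub_le (applyMat A c - v) (applyMat A z - v)]
  have hσ : 0 ≤ σ := (l2Norm_nonneg e).trans he
  set X := l1Norm (c - z)
  have hX : 0 ≤ X := Finset.sum_nonneg fun _ _ => norm_nonneg _
  set R := l2Norm (applyMat A (c - z))
  have hR : 0 ≤ R := l2Norm_nonneg _
  rcases S.eq_empty_or_nonempty with h0 | ⟨a, ha⟩
  · rw [h0, Finset.sum_empty, mul_zero] at hcone
    exact hcone.trans (by positivity)
  have hs : (1 : ℝ) ≤ s := by
    refine le_trans ?_ hcard
    exact_mod_cast Finset.card_pos.2 ⟨a, ha⟩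
  have : Nonempty ι := hι (by exact_mod_cast zero_lt_one.trans_le hs)
  have ht : t ≤ 12 / 25 := by nlinarith
  have hsqrt : Real.sqrt (1 + t) ≤ 5 / 4 := Real.sqrt_le_iff.2 ⟨by norm_num, by linarith⟩
  have hsum : ∑ j ∈ S, ‖(c - z) j‖ ≤ s * (t * X + Real.sqrt (1 + t) * R) := by
    have hB := (norm_nonneg _).trans (norm_apply_le_of_gramDeviationLE hA (c - z) a)
    calc ∑ j ∈ S, ‖(c - z) j‖ ≤ ∑ j ∈ S, (t * X + Real.sqrt (1 + t) * R) :=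
          Finset.sum_le_sum fun j _ => norm_apply_le_of_gramDeviationLE hA (c - z) j
      _ = S.card * (t * X + Real.sqrt (1 + t) * R) := by rw [Finset.sum_const, nsmul_eq_mul]
      _ ≤ _ := mul_le_mul_of_nonneg_right hcard hB
  have hnoise : s * (Real.sqrt (1 + t) * R) ≤ s * (5 / 4 * (2 * σ)) := by gcongr
  have hself : s * t * X ≤ 12 / 25 * X := mul_le_mul_of_nonneg_right hst hX
  linarith

/-- Stable sparse recovery does not depend on the labelling of the rows. -/
lemma StableSparseRecovery.submatrix {ι' : Type*} [Fintype ι'] {A : Matrix ι κ ℝ} {s : ℕ} {d : ℝ}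
    (h : StableSparseRecovery A s d) (f : ι' ≃ ι) :
    StableSparseRecovery (A.submatrix f id) s d := by
  have hl2 : ∀ x : ι' → ℂ, l2Norm x = l2Norm fun i => x (f.symm i) := fun x => by
    rw [l2Norm, l2Norm, Equiv.sum_comp f.symm fun i => ‖x i‖ ^ 2]
  have happ : ∀ c i, applyMat (A.submatrix f id) c (f.symm i) = applyMat A c i := fun c i => by
    simp [applyMat_apply]
  intro c v e σ hc hv he
  have hfeas : bpFeasible (A.submatrix f id) v σ = bpFeasible A (fun i => v (f.symm i)) σ := by
    ext z
    simp only [bpFeasible, Set.mem_ofPred_eq]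
    rw [hl2]
    simp only [Pi.sub_apply, happ, Pi.sub_def]
  have := h c (fun i => v (f.symm i)) (fun i => e (f.symm i)) σ hc
    (by funext i; rw [hv]; simp [happ]) (by rwa [← hl2])
  simpa only [IsBPSolution, hfeas] using this

end Recovery

end CyclicLegendre

/-! ### Legendre polynomials -/

namespace CyclicLegendre

open Polynomial

/-- The iterated derivatives of `w = (X² - 1)^k` satisfy a second-order differential equation,
obtained by differentiating `(X² - 1) w' = 2 k X w`. -/
lemma iterate_derivative_ode (k m : ℕ) :
    ((X : ℝ[X]) ^ 2 - 1) * derivative^[m + 2] ((X ^ 2 - 1) ^ k)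
      + C (2 * ((m : ℝ) + 1 - k)) * X * derivative^[m + 1] ((X ^ 2 - 1) ^ k)
      + C (((m : ℝ) + 1) * (m - 2 * k)) * derivative^[m] ((X ^ 2 - 1) ^ k) = 0 := by
  induction m with
  | zero =>
    have h0 : ((X : ℝ[X]) ^ 2 - 1) * derivative ((X ^ 2 - 1) ^ k)
        = C (2 * (k : ℝ)) * X * (X ^ 2 - 1) ^ k := by
      rcases k with _ | k
      · simp
      · rw [derivative_pow]
        simp only [Nat.add_sub_cancel, derivative_sub, derivative_X_pow, derivative_one, map_mul,
          C_ofNat]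
        push_cast
        simp only [map_add, map_natCast, map_one, C_ofNat]
        ring
    have h1 := congrArg derivative h0
    simp only [derivative_mul, derivative_sub, derivative_X_pow, derivative_one, derivative_C,
      derivative_X] at h1
    simp only [Function.iterate_succ_apply', Function.iterate_zero_apply]
    simp only [map_mul, map_sub, map_add, map_natCast, map_one, C_ofNat, Nat.cast_zero,
      map_zero] at h1 ⊢
    push_cast at h1
    linear_combination h1
  | succ m ih =>
    have h1 := congrArg derivative ih
    simp only [derivative_mul, derivative_sub, derivative_X_pow, derivative_one, derivative_C,
      derivative_X, derivative_add, ← Function.iterate_succ_apply' (⇑derivative), derivative_zero] at h1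
    simp only [map_mul, map_sub, map_add, map_natCast, map_one, C_ofNat, Nat.cast_add,
      Nat.cast_one] at h1 ⊢
    push_cast at h1
    linear_combination h1

/-- Legendre's differential equation. -/
lemma legendrePoly_ode (k : ℕ) :
    (1 - (X : ℝ[X]) ^ 2) * derivative (derivative (legendrePoly k))
      - 2 * X * derivative (legendrePoly k) + C ((k : ℝ) * (k + 1)) * legendrePoly k = 0 := by
  have h := iterate_derivative_ode k k
  simp only [legendrePoly, derivative_C_mul, ← Function.iterate_succ_apply' (⇑derivative)]
  simp only [map_mul, map_sub, map_add, map_natCast, map_one, C_ofNat] at h ⊢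
  linear_combination (-C (1 / ((2 : ℝ) ^ k * (k.factorial : ℝ)))) * h

lemma eval_iterate_derivative_X_sub_C_pow_mul (a : ℝ) (k : ℕ) (q : ℝ[X]) :
    (derivative^[k] ((X - C a) ^ k * q)).eval a = k.factorial * q.eval a := by
  have h : (hasseDeriv k ((X - C a) ^ k * q)).eval a = q.eval a := by
    rw [← taylor_coeff, taylor_mul, taylor_pow]
    simp [coeff_X_pow_mul', taylor_coeff_zero]
  rw [← h, ← factorial_smul_hasseDeriv]
  simp

lemma legendrePoly_eval_one (k : ℕ) : (legendrePoly k).eval 1 = 1 := by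
  have h : ((X : ℝ[X]) ^ 2 - 1) ^ k = (X - C 1) ^ k * (X + C 1) ^ k := by
    rw [← mul_pow]; congr 1; simp; ring
  rw [legendrePoly, h, eval_mul, eval_C, eval_iterate_derivative_X_sub_C_pow_mul]
  have := k.factorial_ne_zero
  simp only [eval_pow, eval_add, eval_X, eval_C]
  norm_num
  field_simp

lemma legendrePoly_eval_neg_one_sq (k : ℕ) : (legendrePoly k).eval (-1) ^ 2 = 1 := by
  have h : ((X : ℝ[X]) ^ 2 - 1) ^ k = (X - C (-1)) ^ k * (X - C 1) ^ k := by
    rw [← mul_pow]; congr 1; simp; ring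
  rw [legendrePoly, h, eval_mul, eval_C, eval_iterate_derivative_X_sub_C_pow_mul]
  have := k.factorial_ne_zero
  have h2 : ((-1 - 1 : ℝ) ^ k) ^ 2 = (2 ^ k) ^ 2 := by
    rw [← pow_mul, ← pow_mul, mul_comm, pow_mul, pow_mul]; norm_num
  simp only [eval_pow, eval_sub, eval_X, eval_C, mul_pow, h2]
  field_simp

/-- Legendre polynomials are bounded by one on `[-1, 1]`. By the differential equation,
`k (k + 1) P_k² + (1 - x²) P_k'²` has derivative `2 x P_k'²`, so its maximum over `[-1, 1]` is
attained at an endpoint, where it equals `k (k + 1)`. -/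
lemma abs_legendrePoly_eval_le_one (k : ℕ) {x : ℝ} (hx : x ∈ Set.Icc (-1 : ℝ) 1) :
    |(legendrePoly k).eval x| ≤ 1 := by
  rcases Nat.eq_zero_or_pos k with rfl | hk
  · simp [legendrePoly]
  have hk' : (0 : ℝ) < k * (k + 1) := by positivity
  set P := legendrePoly k with hP
  set V : ℝ[X] := C ((k : ℝ) * (k + 1)) * P ^ 2 + (1 - X ^ 2) * (derivative P) ^ 2 with hV
  have hdV : derivative V = 2 * X * (derivative P) ^ 2 := by
    have := legendrePoly_ode k
    rw [← hP] at this
    simp only [hV, derivative_add, derivative_mul, derivative_C, derivative_pow, derivative_sub,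
      derivative_one, derivative_X]
    simp only [map_natCast]
    push_cast
    linear_combination (2 * derivative P) * this
  have hV1 : V.eval 1 = k * (k + 1) := by
    simp [hV, hP, legendrePoly_eval_one]
  have hV2 : V.eval (-1) = k * (k + 1) := by
    simp [hV, hP, legendrePoly_eval_neg_one_sq]
  have hle : V.eval x ≤ k * (k + 1) := by
    rcases le_total 0 x with h0 | h0
    · have hmono : MonotoneOn (fun y => V.eval y) (Set.Icc 0 1) := by
        refine monotoneOn_of_deriv_nonneg (convex_Icc 0 1) V.continuous.continuousOn
          V.differentiable.differentiableOn fun y hy => ?_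
        rw [interior_Icc] at hy
        rw [Polynomial.deriv, hdV]
        simp only [eval_mul, eval_pow, eval_ofNat, eval_X]
        have := hy.1.le
        positivity
      rw [← hV1]
      exact hmono ⟨h0, hx.2⟩ ⟨zero_le_one, le_rfl⟩ hx.2
    · have hanti : AntitoneOn (fun y => V.eval y) (Set.Icc (-1) 0) := by
        refine antitoneOn_of_deriv_nonpos (convex_Icc (-1) 0) V.continuous.continuousOn
          V.differentiable.differentiableOn fun y hy => ?_
        rw [interior_Icc] at hy
        rw [Polynomial.deriv, hdV]
        simp only [eval_mul, eval_pow, eval_ofNat, eval_X]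
        nlinarith [hy.2.le, sq_nonneg ((derivative P).eval y)]
      rw [← hV2]
      exact hanti ⟨le_rfl, by norm_num⟩ ⟨hx.1, h0⟩ hx.1
  have hsq : (k * (k + 1) : ℝ) * (P.eval x) ^ 2 ≤ k * (k + 1) * 1 := by
    have : V.eval x = k * (k + 1) * (P.eval x) ^ 2 + (1 - x ^ 2) * ((derivative P).eval x) ^ 2 := by
      simp [hV]
    have h1 : 0 ≤ (1 - x ^ 2) * ((derivative P).eval x) ^ 2 :=
      mul_nonneg (by nlinarith [hx.1, hx.2]) (sq_nonneg _)
    linarith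
  exact (sq_le_one_iff_abs_le_one _).1 (le_of_mul_le_mul_left hsq hk')

lemma integral_mul_derivative (q r : ℝ[X]) (h1 : r.eval 1 = 0) (h2 : r.eval (-1) = 0) :
    ∫ x in (-1 : ℝ)..1, q.eval x * (derivative r).eval x
      = -∫ x in (-1 : ℝ)..1, (derivative q).eval x * r.eval x := by
  rw [intervalIntegral.integral_mul_deriv_eq_deriv_mul (u := fun x => q.eval x)
    (v := fun x => r.eval x) (u' := fun x => (derivative q).eval x)
    (fun x _ => q.hasDerivAt x) (fun x _ => r.hasDerivAt x)
    ((derivative q).continuous.intervalIntegrable _ _)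
    ((derivative r).continuous.intervalIntegrable _ _)]
  simp [h1, h2]

lemma eval_iterate_derivative_X_sq_sub_one_pow {k j : ℕ} (hj : j < k) {a : ℝ} (ha : a ^ 2 = 1) :
    (derivative^[j] (((X : ℝ[X]) ^ 2 - 1) ^ k)).eval a = 0 := by
  obtain ⟨r, hr⟩ := pow_sub_dvd_iterate_derivative_pow ((X : ℝ[X]) ^ 2 - 1) k j
  rw [hr]
  simp [ha, Nat.sub_ne_zero_of_lt hj]

/-- A Legendre polynomial is orthogonal to every polynomial of smaller degree, by repeated
integration by parts in Rodrigues' formula. -/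
lemma integral_mul_legendrePoly_of_natDegree_lt {k : ℕ} {q : ℝ[X]} (hq : q.natDegree < k) :
    ∫ x in (-1 : ℝ)..1, q.eval x * (legendrePoly k).eval x = 0 := by
  have key : ∀ j ≤ k, ∫ x in (-1 : ℝ)..1, q.eval x * (derivative^[k] ((X ^ 2 - 1) ^ k)).eval x
      = (-1) ^ j * ∫ x in (-1 : ℝ)..1, (derivative^[j] q).eval x *
        (derivative^[k - j] ((X ^ 2 - 1) ^ k)).eval x := by
    intro j hj
    induction j with
    | zero => simp
    | succ j ih =>
      have hs : k - j = (k - (j + 1)) + 1 := by omega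
      rw [ih (by omega), hs, Function.iterate_succ_apply', integral_mul_derivative,
        Function.iterate_succ_apply', pow_succ]
      · ring
      · exact eval_iterate_derivative_X_sq_sub_one_pow (by omega) (by norm_num)
      · exact eval_iterate_derivative_X_sq_sub_one_pow (by omega) (by norm_num)
  have h := key k le_rfl
  rw [iterate_derivative_eq_zero hq] at h
  simp only [eval_zero, zero_mul, intervalIntegral.integral_zero, mul_zero] at h
  simp only [legendrePoly, eval_mul, eval_C]
  simp_rw [mul_left_comm _ (1 / ((2 : ℝ) ^ k * (k.factorial : ℝ)))]
  rw [intervalIntegral.integral_const_mul, h, mul_zero]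

lemma natDegree_legendrePoly_le (k : ℕ) : (legendrePoly k).natDegree ≤ k := by
  refine (natDegree_C_mul_le _ _).trans ?_
  refine (natDegree_iterate_derivative _ _).trans ?_
  have : (((X : ℝ[X]) ^ 2 - 1) ^ k).natDegree ≤ k * 2 := by
    refine natDegree_pow_le_of_le k ?_
    compute_degree
  omega

lemma integral_legendrePoly_mul_of_ne {j k : ℕ} (hjk : j ≠ k) :
    ∫ x in (-1 : ℝ)..1, (legendrePoly j).eval x * (legendrePoly k).eval x = 0 := by
  rcases lt_or_gt_of_ne hjk with h | h
  · exact integral_mul_legendrePoly_of_natDegree_lt ((natDegree_legendrePoly_le j).trans_lt h)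
  · simp_rw [mul_comm ((legendrePoly j).eval _)]
    exact integral_mul_legendrePoly_of_natDegree_lt ((natDegree_legendrePoly_le k).trans_lt h)

/-- The square norm of `P_k`: integrate `(x P_k²)'` and note that `x P_k' - k P_k` has degree less
than `k`, hence is orthogonal to `P_k`. -/
lemma integral_legendrePoly_sq (k : ℕ) :
    ∫ x in (-1 : ℝ)..1, (legendrePoly k).eval x * (legendrePoly k).eval x = 2 / (2 * k + 1) := by
  set P := legendrePoly k with hP
  have hFTC : ∫ x in (-1 : ℝ)..1, (derivative (X * P ^ 2)).eval x = 2 := by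
    rw [intervalIntegral.integral_eq_sub_of_hasDerivAt (f := fun x => (X * P ^ 2).eval x)
      (fun x _ => (X * P ^ 2).hasDerivAt x) ((derivative _).continuous.intervalIntegrable _ _)]
    simp only [eval_mul, eval_X, eval_pow, hP, legendrePoly_eval_one, legendrePoly_eval_neg_one_sq]
    norm_num
  have horth : ∫ x in (-1 : ℝ)..1, (X * derivative P - C (k : ℝ) * P).eval x * P.eval x = 0 := by
    rcases Nat.eq_zero_or_pos k with rfl | hk
    · simp [hP, legendrePoly]
    refine integral_mul_legendrePoly_of_natDegree_lt ?_
    rw [← Nat.le_sub_one_iff_lt hk, natDegree_le_iff_coeff_eq_zero]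
    intro m hm
    obtain ⟨m, rfl⟩ : ∃ l, m = l + 1 := ⟨m - 1, by omega⟩
    rw [coeff_sub, coeff_X_mul, coeff_C_mul, coeff_derivative]
    rcases Nat.lt_or_ge k (m + 1) with h | h
    · rw [coeff_eq_zero_of_natDegree_lt ((natDegree_legendrePoly_le k).trans_lt h)]; simp
    · have : (k : ℝ) = m + 1 := by
        have : k = m + 1 := by omega
        exact_mod_cast this
      rw [this]; ring
  have hid : ∀ x, (derivative (X * P ^ 2)).eval x
      = 2 * ((X * derivative P - C (k : ℝ) * P).eval x * P.eval x)
        + (2 * k + 1) * (P.eval x * P.eval x) := by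
    intro x
    simp only [derivative_mul, derivative_X, derivative_pow, eval_add, eval_mul, eval_X, eval_pow,
      eval_sub, eval_C, eval_one]
    norm_num
    ring
  simp_rw [hid] at hFTC
  rw [intervalIntegral.integral_add, intervalIntegral.integral_const_mul, horth,
    intervalIntegral.integral_const_mul] at hFTC
  · have : (0 : ℝ) < 2 * k + 1 := by positivity
    rw [eq_div_iff this.ne']; linarith
  · exact Continuous.intervalIntegrable (by fun_prop) _ _
  · exact Continuous.intervalIntegrable (by fun_prop) _ _

lemma continuous_normLegendre (k : ℕ) : Continuous (normLegendre k) := by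
  unfold normLegendre; fun_prop

lemma abs_normLegendre_le (k : ℕ) {x : ℝ} (hx : x ∈ Set.Icc (-1 : ℝ) 1) :
    |normLegendre k x| ≤ Real.sqrt (2 * k + 1) := by
  rw [normLegendre, abs_mul, abs_of_nonneg (Real.sqrt_nonneg _)]
  exact mul_le_of_le_one_right (Real.sqrt_nonneg _) (abs_legendrePoly_eval_le_one k hx)

lemma normLegendre_zero (x : ℝ) : normLegendre 0 x = 1 := by
  simp [normLegendre, legendrePoly]

/-- The normalized Legendre polynomials are orthonormal for the uniform law on `[-1, 1]`. -/
lemma integral_normLegendre_mul (j k : ℕ) :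
    ∫ x, normLegendre j x * normLegendre k x ∂(cond volume (Set.Icc (-1 : ℝ) 1))
      = if j = k then 1 else 0 := by
  have hred : ∫ x, normLegendre j x * normLegendre k x ∂(cond volume (Set.Icc (-1 : ℝ) 1))
      = 2⁻¹ * (Real.sqrt (2 * j + 1) * Real.sqrt (2 * k + 1) *
        ∫ x in (-1 : ℝ)..1, (legendrePoly j).eval x * (legendrePoly k).eval x) := by
    rw [ProbabilityTheory.cond, integral_smul_measure, integral_Icc_eq_integral_Ioc,
      ← intervalIntegral.integral_of_le (by norm_num), ← intervalIntegral.integral_const_mul]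
    congr 1
    · simp; norm_num
    · refine intervalIntegral.integral_congr fun x _ => ?_
      simp only [normLegendre]; ring
  rw [hred]
  split_ifs with h
  · subst h
    rw [integral_legendrePoly_sq, Real.mul_self_sqrt (by positivity)]
    have : (0 : ℝ) < 2 * j + 1 := by positivity
    field_simp
  · rw [integral_legendrePoly_mul_of_ne h]; simp

end CyclicLegendre

/-! ### The bounded differences inequality -/

namespace CyclicLegendre

section BoundedDifferences

open scoped NNReal

/-- A function on a product of probability spaces is sub-Gaussian if it varies by at most `a` in
the first variable and its fibres over the first variable are sub-Gaussian with a uniform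
parameter. The mean over the fibre varies by at most `a` too, so Hoeffding's lemma applies to it. -/
lemma hasSubgaussianMGF_prod {α β : Type*} [MeasurableSpace α] [MeasurableSpace β]
    {μ : Measure α} {ν : Measure β} [IsProbabilityMeasure μ] [IsProbabilityMeasure ν]
    {F : α × β → ℝ} (hF : Measurable F) {B : ℝ} (hB : ∀ z, |F z| ≤ B) {a c : ℝ≥0}
    (ha : ∀ x x' y, |F (x, y) - F (x', y)| ≤ a)
    (hc : ∀ x, HasSubgaussianMGF (fun y => F (x, y) - ∫ y', F (x, y') ∂ν) c ν) :
    HasSubgaussianMGF (fun z => F z - ∫ z', F z' ∂(μ.prod ν)) ((a / 2) ^ 2 + c) (μ.prod ν) := by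
  have hint : ∀ x, Integrable (fun y => F (x, y)) ν := fun x =>
    Integrable.of_bound (hF.comp measurable_prodMk_left).aestronglyMeasurable B
      (Filter.Eventually.of_forall fun y => hB (x, y))
  have hFint : Integrable F (μ.prod ν) :=
    Integrable.of_bound hF.aestronglyMeasurable B (Filter.Eventually.of_forall hB)
  set g : α → ℝ := fun x => ∫ y, F (x, y) ∂ν with hg
  have hgm : Measurable g := hF.stronglyMeasurable.integral_prod_right'.measurable
  have hmean : ∫ z, F z ∂(μ.prod ν) = ∫ x, g x ∂μ := integral_prod F hFint
  have hgdiff : ∀ x x', g x - g x' ≤ a := by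
    intro x x'
    rw [hg, ← integral_sub (hint x) (hint x')]
    calc ∫ y, F (x, y) - F (x', y) ∂ν ≤ ∫ _, (a : ℝ) ∂ν :=
          integral_mono ((hint x).sub (hint x')) (integrable_const _)
            fun y => (le_abs_self _).trans (ha x x' y)
      _ = a := by simp
  have hgsub : HasSubgaussianMGF (fun x => g x - ∫ x', g x' ∂μ) ((a / 2) ^ 2) μ := by
    obtain ⟨x₀⟩ : Nonempty α := μ.nonempty_of_neZero
    have : Nonempty α := ⟨x₀⟩
    have hbdd : BddBelow (Set.range g) := by
      refine ⟨g x₀ - a, ?_⟩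
      rintro _ ⟨x, rfl⟩
      linarith [hgdiff x₀ x]
    have h := hasSubgaussianMGF_of_mem_Icc (μ := μ) (X := g) (a := ⨅ x, g x) (b := (⨅ x, g x) + a)
      hgm.aemeasurable (Filter.Eventually.of_forall fun x =>
        ⟨ciInf_le hbdd x, by
          have : g x - a ≤ ⨅ x, g x := le_ciInf fun x' => by linarith [hgdiff x x']
          linarith⟩)
    simpa using h
  have hbound : ∀ z : α × β, |F z - ∫ z', F z' ∂(μ.prod ν)| ≤ B + B := by
    intro z
    have h1 : |∫ z', F z' ∂(μ.prod ν)| ≤ B := by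
      simpa using norm_integral_le_of_norm_le_const (μ := μ.prod ν) (f := F) (C := B) (Filter.Eventually.of_forall hB)
    exact (abs_sub _ _).trans (add_le_add (hB z) h1)
  have hexp : ∀ t : ℝ, Integrable (fun z => Real.exp (t * (F z - ∫ z', F z' ∂(μ.prod ν))))
      (μ.prod ν) := fun t =>
    integrable_exp_mul_of_mem_Icc (a := -(B + B)) (b := B + B) (hF.sub_const _).aemeasurable
      (Filter.Eventually.of_forall fun z => abs_le.1 (hbound z))
  refine ⟨hexp, fun t => ?_⟩
  rw [mgf, integral_prod _ (hexp t), hmean]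
  calc ∫ x, ∫ y, Real.exp (t * (F (x, y) - ∫ x', g x' ∂μ)) ∂ν ∂μ
      ≤ ∫ x, Real.exp (t * (g x - ∫ x', g x' ∂μ)) * Real.exp (c * t ^ 2 / 2) ∂μ := by
        refine integral_mono ?_ ((hgsub.integrable_exp_mul t).mul_const _) fun x => ?_
        · have := (hexp t).integral_prod_left
          rwa [hmean] at this
        · have h1 : ∀ y, Real.exp (t * (F (x, y) - ∫ x', g x' ∂μ))
              = Real.exp (t * (g x - ∫ x', g x' ∂μ)) * Real.exp (t * (F (x, y) - g x)) := by
            intro y; rw [← Real.exp_add]; congr 1; ring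
          simp only [h1]
          rw [integral_const_mul]
          exact mul_le_mul_of_nonneg_left ((hc x).mgf_le t) (Real.exp_nonneg _)
    _ = (∫ x, Real.exp (t * (g x - ∫ x', g x' ∂μ)) ∂μ) * Real.exp (c * t ^ 2 / 2) :=
        integral_mul_const _ _
    _ ≤ Real.exp (((a / 2) ^ 2 : ℝ≥0) * t ^ 2 / 2) * Real.exp (c * t ^ 2 / 2) :=
        mul_le_mul_of_nonneg_right (hgsub.mgf_le t) (Real.exp_nonneg _)
    _ = _ := by rw [← Real.exp_add]; congr 1; push_cast; ring

/-- McDiarmid's inequality on a product space: a bounded function which varies by at most `a i` in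
the `i`-th variable is sub-Gaussian about its mean with parameter `∑ (a i / 2)²`. -/
theorem hasSubgaussianMGF_pi_of_bounded_differences {m : ℕ} {E : Type*}
    [MeasurableSpace E] (μ : Fin m → Measure E) [∀ i, IsProbabilityMeasure (μ i)]
    {F : (Fin m → E) → ℝ} (hF : Measurable F) {B : ℝ} (hB : ∀ x, |F x| ≤ B) (a : Fin m → ℝ≥0)
    (ha : ∀ i x x', (∀ j, j ≠ i → x j = x' j) → |F x - F x'| ≤ a i) :
    HasSubgaussianMGF (fun x => F x - ∫ y, F y ∂(Measure.pi μ)) (∑ i, (a i / 2) ^ 2)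
      (Measure.pi μ) := by
  induction m with
  | zero =>
    have h : (fun x => F x - ∫ y, F y ∂(Measure.pi μ)) = fun _ => 0 := by
      funext x
      have : ∀ y, F y = F x := fun y => congrArg F (Subsingleton.elim y x)
      simp [this]
    rw [h]
    simp
  | succ m ih =>
    set e : (Fin (m + 1) → E) ≃ᵐ E × (Fin m → E) :=
      MeasurableEquiv.piFinSuccAbove (fun _ => E) 0 with he
    have hmp : MeasurePreserving e (Measure.pi μ)
        ((μ 0).prod (Measure.pi fun j => μ (Fin.succAbove 0 j))) :=
      measurePreserving_piFinSuccAbove μ 0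
    have hsymm : ∀ x y, e.symm (x, y) = (Fin.cons x y : Fin (m + 1) → E) := fun x y =>
      Fin.insertNth_zero' x y
    have hprod := hasSubgaussianMGF_prod (μ := μ 0) (ν := Measure.pi fun j => μ (Fin.succAbove 0 j))
      (F := F ∘ e.symm) (hF.comp e.symm.measurable) (B := B) (fun z => hB _) (a := a 0)
      (c := ∑ i : Fin m, (a i.succ / 2) ^ 2)
      (fun x x' y => ha 0 _ _ fun j hj => by
        obtain ⟨j, rfl⟩ := Fin.exists_succ_eq.2 hj
        simp [hsymm])
      (fun x => ih (fun j => μ (Fin.succAbove 0 j))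
        (hF.comp (e.symm.measurable.comp measurable_prodMk_left)) (fun y => hB _)
        (fun i => a i.succ) fun i y y' hyy' => ha i.succ _ _ fun j hj => by
          obtain rfl | ⟨j, rfl⟩ := Fin.eq_zero_or_eq_succ j
          · simp [hsymm]
          · simpa [hsymm] using hyy' j fun h => hj (by rw [h]))
    have hcomp := HasSubgaussianMGF.of_map (μ := Measure.pi μ) (Y := e) e.measurable.aemeasurable
      (by rw [hmp.map_eq]; exact hprod)
    rw [Fin.sum_univ_succ]
    refine hcomp.congr (Filter.Eventually.of_forall fun x => ?_)
    have hi : ∫ z, (F ∘ e.symm) z ∂((μ 0).prod (Measure.pi fun j => μ (Fin.succAbove 0 j)))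
        = ∫ y, F y ∂(Measure.pi μ) := by
      rw [← hmp.integral_comp']
      simp
    simp only [Function.comp_apply, MeasurableEquiv.symm_apply_apply] at hi ⊢
    rw [hi]

/-- McDiarmid's inequality for a function of finitely many independent random variables. -/
theorem hasSubgaussianMGF_of_iIndepFun_of_bounded_differences {Ω ι E : Type*} [Fintype ι]
    [MeasurableSpace Ω] [MeasurableSpace E] {P : Measure Ω} [IsProbabilityMeasure P]
    {X : ι → Ω → E} (hX : ∀ i, Measurable (X i)) (hind : iIndepFun X P)
    {F : (ι → E) → ℝ} (hF : Measurable F) {B : ℝ} (hB : ∀ x, |F x| ≤ B) (a : ι → ℝ≥0)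
    (ha : ∀ i x x', (∀ j, j ≠ i → x j = x' j) → |F x - F x'| ≤ a i) :
    HasSubgaussianMGF (fun ω => F (fun i => X i ω) - ∫ ω', F (fun i => X i ω') ∂P)
      (∑ i, (a i / 2) ^ 2) P := by
  set e : Fin (Fintype.card ι) ≃ ι := (Fintype.equivFin ι).symm with he
  have hind' : iIndepFun (fun k => X (e k)) P := hind.precomp e.injective
  have hmap := (iIndepFun_iff_map_fun_eq_pi_map fun k => (hX (e k)).aemeasurable).1 hind'
  have hprob : ∀ k, IsProbabilityMeasure (P.map (X (e k))) := fun k =>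
    Measure.isProbabilityMeasure_map (hX _).aemeasurable
  set G : (Fin (Fintype.card ι) → E) → ℝ := fun y => F (fun i => y (e.symm i)) with hG
  have hGm : Measurable G := hF.comp (measurable_pi_lambda _ fun i => measurable_pi_apply _)
  have h := hasSubgaussianMGF_pi_of_bounded_differences (fun k => P.map (X (e k))) hGm
    (fun y => hB _) (fun k => a (e k)) fun k y y' hyy' =>
      ha (e k) _ _ fun j hj => hyy' _ fun h => hj (by rw [← h, Equiv.apply_symm_apply])
  have hY : Measurable fun ω k => X (e k) ω := measurable_pi_lambda _ fun k => hX _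
  rw [← hmap] at h
  rw [integral_map hY.aemeasurable hGm.aestronglyMeasurable] at h
  have h' := h.of_map hY.aemeasurable
  rw [Equiv.sum_comp e fun i => (a i / 2) ^ 2] at h'
  simpa [Function.comp_def, hG] using h'

/-- The two-sided tail bound for a sub-Gaussian variable. -/
lemma measureReal_abs_ge_le_of_hasSubgaussianMGF {Ω : Type*} [MeasurableSpace Ω] {P : Measure Ω}
    [IsFiniteMeasure P] {X : Ω → ℝ} {c : ℝ≥0} (h : HasSubgaussianMGF X c P) {ε : ℝ} (hε : 0 ≤ ε) :
    P.real {ω | ε ≤ |X ω|} ≤ 2 * Real.exp (-ε ^ 2 / (2 * c)) := by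
  have hsub : {ω | ε ≤ |X ω|} ⊆ {ω | ε ≤ X ω} ∪ {ω | ε ≤ (-X) ω} := by
    intro ω hω
    simpa [le_abs] using hω
  refine (measureReal_mono hsub).trans ((measureReal_union_le _ _).trans ?_)
  linarith [h.measure_ge_le hε, h.neg.measure_ge_le hε]

end BoundedDifferences

end CyclicLegendre

/-! ### Counting multi-indices -/

namespace CyclicLegendre

/-- An upper bound for the number of multi-indices, from the generating function
`∑ x^|α| = (∑ x^k)^n` at `x = p / (n + p)`. -/
lemma card_multiIdx_le {n p : ℕ} (hn : 0 < n) (hp : 0 < p) :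
    (Fintype.card (MultiIdx n p) : ℝ) ≤ (Real.exp 1 / p * (n + p)) ^ p := by
  have hn' : (0 : ℝ) < n := by exact_mod_cast hn
  have hp' : (0 : ℝ) < p := by exact_mod_cast hp
  set x : ℝ := p / (n + p) with hx
  have hx0 : 0 < x := by positivity
  have hx1 : x < 1 := by rw [hx, div_lt_one (by positivity)]; linarith
  have hmass : (Fintype.card (MultiIdx n p) : ℝ) * x ^ p ≤ (∑ k : Fin (p + 1), x ^ (k : ℕ)) ^ n := by
    calc (Fintype.card (MultiIdx n p) : ℝ) * x ^ p = ∑ _α : MultiIdx n p, x ^ p := by simp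
      _ ≤ ∑ α : MultiIdx n p, ∏ j, x ^ (α.1 j : ℕ) := by
          refine Finset.sum_le_sum fun α _ => ?_
          rw [Finset.prod_pow_eq_pow_sum]
          exact pow_le_pow_of_le_one hx0.le hx1.le α.2
      _ = ∑ α ∈ Finset.univ.filter (fun α : Fin n → Fin (p + 1) => ∑ j, (α j : ℕ) ≤ p),
            ∏ j, x ^ (α j : ℕ) :=
          (Finset.sum_subtype _ (by simp) (fun α : Fin n → Fin (p + 1) => ∏ j, x ^ (α j : ℕ))).symm
      _ ≤ ∑ α : Fin n → Fin (p + 1), ∏ j, x ^ (α j : ℕ) :=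
          Finset.sum_le_sum_of_subset_of_nonneg (Finset.filter_subset _ _)
            fun α _ _ => Finset.prod_nonneg fun j _ => by positivity
      _ = _ := (Fintype.sum_pow (fun k : Fin (p + 1) => x ^ (k : ℕ)) n).symm
  have hgeom : ∑ k : Fin (p + 1), x ^ (k : ℕ) ≤ 1 + p / n := by
    rw [Fin.sum_univ_eq_sum_range (fun k => x ^ k)]
    have h1 : (∑ k ∈ Finset.range (p + 1), x ^ k) * (1 - x) ≤ 1 := by
      rw [geom_sum_mul_neg]
      linarith [pow_pos hx0 (p + 1)]
    have h2 : (1 + p / n) * (1 - x) = 1 := by rw [hx]; field_simp; ring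
    exact le_of_mul_le_mul_right (h1.trans_eq h2.symm) (by linarith)
  have hexp : (1 + p / n : ℝ) ^ n ≤ Real.exp 1 ^ p := by
    have h1 : (1 + p / n : ℝ) ≤ Real.exp (p / n) := by linarith [Real.add_one_le_exp (p / n : ℝ)]
    calc (1 + p / n : ℝ) ^ n ≤ Real.exp (p / n) ^ n := pow_le_pow_left₀ (by positivity) h1 n
      _ = Real.exp 1 ^ p := by
        rw [← Real.exp_nat_mul, ← Real.exp_nat_mul]; congr 1; field_simp
  have hfin : (Fintype.card (MultiIdx n p) : ℝ) * x ^ p ≤ Real.exp 1 ^ p :=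
    hmass.trans ((pow_le_pow_left₀ (by positivity) hgeom n).trans hexp)
  have hid : (Real.exp 1 / p * (n + p)) ^ p * x ^ p = Real.exp 1 ^ p := by
    rw [← mul_pow, hx]; congr 1; field_simp
  exact le_of_mul_le_mul_right (hfin.trans_eq hid.symm) (by positivity)

/-- The union bound over all pairs of columns is affordable: `(1 + 1/(2p))^(2p) ≥ 2` absorbs the
factor `2`, and `n + p ≤ n (3/2)^p ≤ n^(1 + 3p/5)`. -/
lemma card_sq_mul_exp_lt {n p : ℕ} (hn : 2 ≤ n) (hp : 1 ≤ p) :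
    (Fintype.card (MultiIdx n p) : ℝ) ^ 2 * (2 * Real.exp (-(4 * p ^ 4 * Real.log n)))
      < (Real.exp 1 / (p : ℝ) + Real.exp 1 / (2 * (p : ℝ) ^ 2)) ^ (2 * p) *
        (n : ℝ) ^ (-(2 * (p : ℝ) / 11)) := by
  have hn2 : (2 : ℝ) ≤ n := by exact_mod_cast hn
  have hp1 : (1 : ℝ) ≤ p := by exact_mod_cast hp
  set L := Real.log n with hL
  have hL2 : Real.log 2 ≤ L := Real.log_le_log (by norm_num) hn2
  have hL0 : 0 < L := (Real.log_pos (by norm_num)).trans_le hL2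
  have hcard : (Fintype.card (MultiIdx n p) : ℝ) ^ 2
      ≤ (Real.exp 1 / p) ^ (2 * p) * (n + p : ℝ) ^ (2 * p) := by
    calc (Fintype.card (MultiIdx n p) : ℝ) ^ 2 ≤ ((Real.exp 1 / p * (n + p)) ^ p) ^ 2 :=
          pow_le_pow_left₀ (Nat.cast_nonneg _) (card_multiIdx_le (by omega) hp) 2
      _ = _ := by rw [← pow_mul, mul_comm p 2, mul_pow]
  have htwo : 2 * (Real.exp 1 / p) ^ (2 * p)
      ≤ (Real.exp 1 / (p : ℝ) + Real.exp 1 / (2 * (p : ℝ) ^ 2)) ^ (2 * p) := by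
    have h1 : Real.exp 1 / (p : ℝ) + Real.exp 1 / (2 * (p : ℝ) ^ 2)
        = (1 + 1 / (2 * p)) * (Real.exp 1 / p) := by field_simp
    have h2 : (2 : ℝ) ≤ (1 + 1 / (2 * p)) ^ (2 * p) := by
      have h := one_add_mul_le_pow (a := (1 / (2 * p) : ℝ))
        (le_trans (by norm_num) (by positivity : (0 : ℝ) ≤ 1 / (2 * p))) (2 * p)
      have h3 : 1 + ((2 * p : ℕ) : ℝ) * (1 / (2 * p)) = 2 := by
        push_cast; field_simp; norm_num
      linarith
    rw [h1, mul_pow]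
    gcongr
  have hthreehalves : (3 / 2 : ℝ) ≤ Real.exp (3 / 5 * L) := by
    rw [← Real.log_le_iff_le_exp (by norm_num)]
    have h : Real.log ((3 / 2) ^ 5) ≤ Real.log (2 ^ 3) := Real.log_le_log (by norm_num) (by norm_num)
    rw [Real.log_pow, Real.log_pow] at h
    push_cast at h
    linarith
  have hnp : (n + p : ℝ) ≤ Real.exp (L * (1 + 3 / 5 * p)) := by
    have h1 : (1 + p / 2 : ℝ) ≤ (3 / 2) ^ p := by
      have := one_add_mul_le_pow (a := (1 / 2 : ℝ)) (by norm_num) p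
      norm_num at this
      linarith
    have h2 : (3 / 2 : ℝ) ^ p ≤ Real.exp (3 / 5 * L) ^ p :=
      pow_le_pow_left₀ (by norm_num) hthreehalves p
    calc (n + p : ℝ) ≤ n * (1 + p / 2) := by nlinarith
      _ ≤ n * Real.exp (3 / 5 * L) ^ p := by gcongr; exact h1.trans h2
      _ = _ := by
        rw [← Real.exp_nat_mul]
        nth_rw 1 [← Real.exp_log (by linarith : (0 : ℝ) < n)]
        rw [← Real.exp_add]; congr 1; ring
  have hstrict : (n + p : ℝ) ^ (2 * p) * Real.exp (-(4 * p ^ 4 * L))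
      < (n : ℝ) ^ (-(2 * (p : ℝ) / 11)) := by
    calc (n + p : ℝ) ^ (2 * p) * Real.exp (-(4 * p ^ 4 * L))
        ≤ Real.exp (L * (1 + 3 / 5 * p)) ^ (2 * p) * Real.exp (-(4 * p ^ 4 * L)) := by gcongr
      _ = Real.exp (L * (2 * p + 6 / 5 * p ^ 2 - 4 * p ^ 4)) := by
        rw [← Real.exp_nat_mul, ← Real.exp_add]; congr 1; push_cast; ring
      _ < Real.exp (L * (-(2 * p / 11))) := by
        refine Real.exp_lt_exp.2 (mul_lt_mul_of_pos_left ?_ hL0)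
        have h2 : (p : ℝ) ≤ p ^ 2 := by nlinarith
        have h4 : (p : ℝ) ^ 2 ≤ p ^ 4 := by nlinarith
        linarith
      _ = _ := by rw [Real.rpow_def_of_pos (by linarith)]
  have he : 0 < (Real.exp 1 / p) ^ (2 * p) := by positivity
  calc (Fintype.card (MultiIdx n p) : ℝ) ^ 2 * (2 * Real.exp (-(4 * p ^ 4 * L)))
      ≤ ((Real.exp 1 / p) ^ (2 * p) * (n + p : ℝ) ^ (2 * p))
        * (2 * Real.exp (-(4 * p ^ 4 * L))) := by gcongr
    _ = (2 * (Real.exp 1 / p) ^ (2 * p))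
        * ((n + p : ℝ) ^ (2 * p) * Real.exp (-(4 * p ^ 4 * L))) := by ring
    _ < (2 * (Real.exp 1 / p) ^ (2 * p)) * (n : ℝ) ^ (-(2 * (p : ℝ) / 11)) := by gcongr
    _ ≤ _ := by gcongr

/-! ### Tensorized Legendre polynomials -/

lemma card_support_multiIdx_le {n p : ℕ} (α : MultiIdx n p) :
    (Finset.univ.filter fun j => (α.1 j : ℕ) ≠ 0).card ≤ p := by
  refine le_trans ?_ α.2
  rw [Finset.card_filter]
  refine Finset.sum_le_sum fun j _ => ?_
  split_ifs with h <;> omega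

lemma tensorLegendre_congr {n p : ℕ} (α : MultiIdx n p) {x y : Fin n → ℝ}
    (h : ∀ j, (α.1 j : ℕ) ≠ 0 → x j = y j) : tensorLegendre α x = tensorLegendre α y := by
  refine Finset.prod_congr rfl fun j _ => ?_
  by_cases hj : (α.1 j : ℕ) = 0
  · rw [hj, normLegendre_zero, normLegendre_zero]
  · rw [h j hj]

lemma continuous_tensorLegendre {n p : ℕ} (α : MultiIdx n p) :
    Continuous (tensorLegendre α) :=
  continuous_finsetProd _ fun j _ => (continuous_normLegendre _).comp (continuous_apply j)

lemma abs_tensorLegendre_le {n p : ℕ} (α : MultiIdx n p) {x : Fin n → ℝ}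
    (hx : ∀ j, x j ∈ Set.Icc (-1 : ℝ) 1) : |tensorLegendre α x| ≤ Real.sqrt 3 ^ p := by
  have hfac : ∀ j, |normLegendre (α.1 j : ℕ) (x j)| ≤ Real.sqrt 3 ^ (α.1 j : ℕ) := by
    intro j
    refine (abs_normLegendre_le _ (hx j)).trans ?_
    rw [Real.sqrt_le_left (by positivity), pow_right_comm, Real.sq_sqrt (by norm_num)]
    have := one_add_mul_le_pow (a := (2 : ℝ)) (by norm_num) (α.1 j : ℕ)
    norm_num at this
    linarith
  rw [tensorLegendre, Finset.abs_prod]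
  refine (Finset.prod_le_prod (fun _ _ => abs_nonneg _) fun j _ => hfac j).trans ?_
  rw [Finset.prod_pow_eq_pow_sum]
  exact pow_le_pow_right₀ (Real.one_le_sqrt.2 (by norm_num)) α.2

lemma abs_tensorLegendre_mul_le {n p : ℕ} (α β : MultiIdx n p) {x : Fin n → ℝ}
    (hx : ∀ j, x j ∈ Set.Icc (-1 : ℝ) 1) : |tensorLegendre α x * tensorLegendre β x| ≤ 3 ^ p := by
  have h3 : (3 : ℝ) ^ p = Real.sqrt 3 ^ p * Real.sqrt 3 ^ p := by
    rw [← mul_pow, Real.mul_self_sqrt (by norm_num)]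
  rw [abs_mul, h3]
  exact mul_le_mul (abs_tensorLegendre_le α hx) (abs_tensorLegendre_le β hx) (abs_nonneg _)
    (by positivity)

/-- Tensorized Legendre polynomials are orthonormal under independent uniform variables. -/
lemma integral_tensorLegendre_mul {Ω : Type*} [MeasurableSpace Ω] {P : Measure Ω}
    [IsProbabilityMeasure P] {n p : ℕ} {X : Fin n → Ω → ℝ} (hX : ∀ j, Measurable (X j))
    (hind : iIndepFun X P) (hunif : ∀ j, pdf.IsUniform (X j) (Set.Icc (-1 : ℝ) 1) P volume)
    (α β : MultiIdx n p) :
    ∫ ω, tensorLegendre α (fun j => X j ω) * tensorLegendre β (fun j => X j ω) ∂P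
      = if α = β then 1 else 0 := by
  have hcont : ∀ j, Continuous fun x : ℝ =>
      normLegendre (α.1 j : ℕ) x * normLegendre (β.1 j : ℕ) x := fun j =>
    (continuous_normLegendre _).mul (continuous_normLegendre _)
  have hprod : ∫ ω, tensorLegendre α (fun j => X j ω) * tensorLegendre β (fun j => X j ω) ∂P
      = ∏ j, ∫ ω, normLegendre (α.1 j : ℕ) (X j ω) * normLegendre (β.1 j : ℕ) (X j ω) ∂P := by
    simp only [tensorLegendre, ← Finset.prod_mul_distrib]
    exact hind.integral_fun_prod_comp (fun j => (hX j).aemeasurable)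
      (f := fun j x => normLegendre (α.1 j : ℕ) x * normLegendre (β.1 j : ℕ) x)
      fun j => (hcont j).aestronglyMeasurable
  have hfac : ∀ j, ∫ ω, normLegendre (α.1 j : ℕ) (X j ω) * normLegendre (β.1 j : ℕ) (X j ω) ∂P
      = if α.1 j = β.1 j then 1 else 0 := by
    intro j
    rw [← integral_map (f := fun x => normLegendre (α.1 j : ℕ) x * normLegendre (β.1 j : ℕ) x)
      (hX j).aemeasurable (hcont j).aestronglyMeasurable, hunif j, integral_normLegendre_mul]
    simp only [Fin.val_inj]
  rw [hprod]
  simp only [hfac, Finset.prod_ite_zero, Finset.prod_const_one, Finset.mem_univ, forall_const]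
  simp only [Subtype.ext_iff, funext_iff]

/-! ### Concentration of the Gram matrix -/

/-- The entry at `(α, β)` of `Aᵀ A`, where `A` is the sampling matrix of the `K` vectors listed
in `w`. -/
noncomputable def gramEntry {K n p : ℕ} (α β : MultiIdx n p) (w : Fin K × Fin n → ℝ) : ℝ :=
  ∑ r : Fin K × Fin n, tensorLegendre α (fun j => w (r.1, r.2 + j)) *
    tensorLegendre β (fun j => w (r.1, r.2 + j))

lemma continuous_gramEntry {K n p : ℕ} (α β : MultiIdx n p) :
    Continuous (gramEntry (K := K) α β) := by
  refine continuous_finsetSum _ fun r _ => Continuous.mul ?_ ?_ <;>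
  exact (continuous_tensorLegendre _).comp (continuous_pi fun j => continuous_apply _)

lemma abs_gramEntry_le {K n p : ℕ} (α β : MultiIdx n p) {w : Fin K × Fin n → ℝ}
    (hw : ∀ q, w q ∈ Set.Icc (-1 : ℝ) 1) : |gramEntry α β w| ≤ K * n * 3 ^ p := by
  calc |gramEntry α β w| ≤ ∑ _r : Fin K × Fin n, (3 : ℝ) ^ p :=
        (Finset.abs_sum_le_sum_abs _ _).trans (Finset.sum_le_sum fun r _ =>
          abs_tensorLegendre_mul_le α β fun j => hw _)
    _ = _ := by simp

/-- Each sample enters at most `2 p` rows of the columns `α` and `β`, because `α` and `β` together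
have at most `2 p` active variables. -/
lemma abs_gramEntry_sub_le {K n p : ℕ} [NeZero n] (α β : MultiIdx n p) {w w' : Fin K × Fin n → ℝ}
    (hw : ∀ q, w q ∈ Set.Icc (-1 : ℝ) 1) (hw' : ∀ q, w' q ∈ Set.Icc (-1 : ℝ) 1)
    (q : Fin K × Fin n) (h : ∀ q', q' ≠ q → w q' = w' q') :
    |gramEntry α β w - gramEntry α β w'| ≤ 4 * p * 3 ^ p := by
  classical
  set T : Finset (Fin n) := (Finset.univ.filter fun j => (α.1 j : ℕ) ≠ 0) ∪
    (Finset.univ.filter fun j => (β.1 j : ℕ) ≠ 0) with hT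
  set R : Finset (Fin K × Fin n) := T.image fun j => (q.1, q.2 - j) with hR
  have hRcard : (R.card : ℝ) ≤ 2 * p := by
    have : R.card ≤ 2 * p := by
      refine Finset.card_image_le.trans ((Finset.card_union_le _ _).trans ?_)
      have h1 := card_support_multiIdx_le α
      have h2 := card_support_multiIdx_le β
      omega
    exact_mod_cast this
  have hagree : ∀ r ∉ R, ∀ j ∈ T, w (r.1, r.2 + j) = w' (r.1, r.2 + j) := by
    intro r hr j hj
    refine h _ fun heq => hr ?_
    rw [hR, Finset.mem_image]
    exact ⟨j, hj, by rw [← heq]; simp⟩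
  have hzero : ∀ r ∉ R, tensorLegendre α (fun j => w (r.1, r.2 + j)) *
      tensorLegendre β (fun j => w (r.1, r.2 + j)) - tensorLegendre α (fun j => w' (r.1, r.2 + j)) *
      tensorLegendre β (fun j => w' (r.1, r.2 + j)) = 0 := by
    intro r hr
    rw [tensorLegendre_congr α fun j hj => hagree r hr j (by
        rw [hT, Finset.mem_union, Finset.mem_filter, Finset.mem_filter]
        exact Or.inl ⟨Finset.mem_univ j, hj⟩),
      tensorLegendre_congr β fun j hj => hagree r hr j (by
        rw [hT, Finset.mem_union, Finset.mem_filter, Finset.mem_filter]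
        exact Or.inr ⟨Finset.mem_univ j, hj⟩), sub_self]
  rw [gramEntry, gramEntry, ← Finset.sum_sub_distrib,
    ← Finset.sum_subset (Finset.subset_univ R) fun r _ hr => hzero r hr]
  calc _ ≤ ∑ _r ∈ R, (2 * 3 ^ p : ℝ) := by
        refine (Finset.abs_sum_le_sum_abs _ _).trans (Finset.sum_le_sum fun r _ => ?_)
        refine (abs_sub _ _).trans ?_
        linarith [abs_tensorLegendre_mul_le α β fun j => hw (r.1, r.2 + j),
          abs_tensorLegendre_mul_le α β fun j => hw' (r.1, r.2 + j)]
    _ = R.card * (2 * 3 ^ p) := by rw [Finset.sum_const, nsmul_eq_mul]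
    _ ≤ 2 * p * (2 * 3 ^ p) := by gcongr
    _ = _ := by ring

lemma ae_mem_Icc_of_isUniform {Ω : Type*} [MeasurableSpace Ω] {P : Measure Ω} {X : Ω → ℝ}
    (hX : Measurable X) (hunif : pdf.IsUniform X (Set.Icc (-1 : ℝ) 1) P volume) :
    ∀ᵐ ω ∂P, X ω ∈ Set.Icc (-1 : ℝ) 1 := by
  refine ae_of_ae_map hX.aemeasurable (p := fun x => x ∈ Set.Icc (-1 : ℝ) 1) ?_
  rw [hunif]
  exact ae_cond_mem measurableSet_Icc

section Probability

variable {Ω : Type*} [MeasurableSpace Ω] {P : Measure Ω} [IsProbabilityMeasure P] {K n : ℕ}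
  {X : Fin K × Fin n → Ω → ℝ}

lemma integral_gramEntry [NeZero n] {p : ℕ} (hX : ∀ q, Measurable (X q)) (hind : iIndepFun X P)
    (hunif : ∀ q, pdf.IsUniform (X q) (Set.Icc (-1 : ℝ) 1) P volume) (α β : MultiIdx n p) :
    ∫ ω, gramEntry α β (fun q => X q ω) ∂P = if α = β then (K * n : ℝ) else 0 := by
  simp only [gramEntry]
  rw [integral_finsetSum]
  · have hrow : ∀ r : Fin K × Fin n, ∫ ω, tensorLegendre α (fun j => X (r.1, r.2 + j) ω) *
        tensorLegendre β (fun j => X (r.1, r.2 + j) ω) ∂P = if α = β then 1 else 0 := by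
      intro r
      have hinj : Function.Injective fun j : Fin n => (r.1, r.2 + j) := fun j j' h => by
        simpa using h
      exact integral_tensorLegendre_mul (X := fun j => X (r.1, r.2 + j)) (fun j => hX _)
        (hind.precomp hinj) (fun j => hunif _) α β
    simp only [hrow]
    split_ifs <;> simp
  · intro r _
    have hm : Measurable fun ω => fun j => X (r.1, r.2 + j) ω := measurable_pi_lambda _ fun j => hX _
    refine Integrable.of_bound (((continuous_tensorLegendre α).mul
      (continuous_tensorLegendre β)).measurable.comp hm).aestronglyMeasurable (3 ^ p) ?_
    filter_upwards [ae_all_iff.2 fun q => ae_mem_Icc_of_isUniform (hX q) (hunif q)] with ω hω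
    exact abs_tensorLegendre_mul_le α β fun j => hω _

open scoped NNReal in
/-- McDiarmid's inequality for an entry of the Gram matrix. The samples are first projected onto
`[-1, 1]`, which changes them on a null set only and makes the bounded differences hold
everywhere. -/
lemma hasSubgaussianMGF_gramEntry [NeZero n] {p : ℕ} (hX : ∀ q, Measurable (X q))
    (hind : iIndepFun X P) (hunif : ∀ q, pdf.IsUniform (X q) (Set.Icc (-1 : ℝ) 1) P volume)
    (α β : MultiIdx n p) :
    HasSubgaussianMGF (fun ω => gramEntry α β (fun q => X q ω) - if α = β then (K * n : ℝ) else 0)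
      (K * n * (4 * p ^ 2 * 9 ^ p)) P := by
  set π : ℝ → ℝ := fun x => max (-1) (min 1 x) with hπ
  have hπm : Measurable π := by fun_prop
  have hπI : ∀ x, π x ∈ Set.Icc (-1 : ℝ) 1 := fun x =>
    ⟨le_max_left _ _, max_le (by norm_num) (min_le_left _ _)⟩
  have hπid : ∀ x ∈ Set.Icc (-1 : ℝ) 1, π x = x := fun x hx => by
    rw [hπ]; simp only [min_eq_right hx.2, max_eq_right hx.1]
  have hmc := hasSubgaussianMGF_of_iIndepFun_of_bounded_differences (X := fun q ω => X q ω) hX hind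
    (F := fun w => gramEntry α β fun q => π (w q))
    ((continuous_gramEntry α β).measurable.comp
      (measurable_pi_lambda _ fun q => hπm.comp (measurable_pi_apply q)))
    (fun w => abs_gramEntry_le α β fun q => hπI _) (fun _ => (4 * p * 3 ^ p : ℝ≥0))
    fun q w w' h => by
      have := abs_gramEntry_sub_le α β (w := fun q => π (w q)) (w' := fun q => π (w' q))
        (fun _ => hπI _) (fun _ => hπI _) q fun q' hq' => by rw [h q' hq']
      simpa using this
  have hae : ∀ᵐ ω ∂P, gramEntry α β (fun q => π (X q ω)) = gramEntry α β (fun q => X q ω) := by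
    filter_upwards [ae_all_iff.2 fun q => ae_mem_Icc_of_isUniform (hX q) (hunif q)] with ω hω
    congr 1
    funext q
    exact hπid _ (hω q)
  rw [integral_congr_ae hae, integral_gramEntry hX hind hunif] at hmc
  have hc : ∑ _q : Fin K × Fin n, ((4 * p * 3 ^ p : ℝ≥0) / 2) ^ 2
      = (K * n * (4 * p ^ 2 * 9 ^ p) : ℝ≥0) := by
    have h9 : (9 : ℝ≥0) ^ p = (3 ^ p) ^ 2 := by rw [← pow_mul, mul_comm, pow_mul]; norm_num
    simp only [Finset.sum_const, Finset.card_univ, Fintype.card_prod, Fintype.card_fin,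
      nsmul_eq_mul, Nat.cast_mul]
    rw [h9]
    field_simp
    ring
  rw [hc] at hmc
  refine hmc.congr ?_
  filter_upwards [hae] with ω hω
  rw [hω]

/-- The Gram matrix deviates from `K n` times the identity by at most
`√(32 p^6 9^p K n log n)` in each entry, outside an event of small probability. -/
lemma probBound_lt_measureReal {p : ℕ} (hn : 2 ≤ n) (hp : 1 ≤ p) (hK : 0 < K)
    (hX : ∀ q, Measurable (X q)) (hind : iIndepFun X P)
    (hunif : ∀ q, pdf.IsUniform (X q) (Set.Icc (-1 : ℝ) 1) P volume) :
    MeasurableSet {ω | ∀ α β : MultiIdx n p, |gramEntry α β (fun q => X q ω) -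
      if α = β then (K * n : ℝ) else 0| ≤
        K * n * Real.sqrt (32 * p ^ 6 * 9 ^ p * Real.log n / (K * n))} ∧
    probBound n p < P.real {ω | ∀ α β : MultiIdx n p, |gramEntry α β (fun q => X q ω) -
      if α = β then (K * n : ℝ) else 0| ≤
        K * n * Real.sqrt (32 * p ^ 6 * 9 ^ p * Real.log n / (K * n))} := by
  have : NeZero n := ⟨by omega⟩
  have hn0 : (0 : ℝ) < n := by exact_mod_cast (by omega : 0 < n)
  have hp0 : (0 : ℝ) < p := by exact_mod_cast (by omega : 0 < p)
  have hK0 : (0 : ℝ) < K := by exact_mod_cast hK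
  have hlog : 0 < Real.log n := Real.log_pos (by exact_mod_cast (by omega : 1 < n))
  set t := Real.sqrt (32 * p ^ 6 * 9 ^ p * Real.log n / (K * n)) with ht
  set D : MultiIdx n p → MultiIdx n p → Ω → ℝ := fun α β ω =>
    gramEntry α β (fun q => X q ω) - if α = β then (K * n : ℝ) else 0 with hD
  have hDm : ∀ α β, Measurable (D α β) := fun α β =>
    ((continuous_gramEntry α β).measurable.comp (measurable_pi_lambda _ hX)).sub_const _
  set E : Set Ω := {ω | ∀ α β, |D α β ω| ≤ K * n * t} with hE
  have hEm : MeasurableSet E := by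
    have : E = ⋂ α, ⋂ β, {ω | |D α β ω| ≤ K * n * t} := by ext ω; simp [hE]
    rw [this]
    exact MeasurableSet.iInter fun α => MeasurableSet.iInter fun β =>
      measurableSet_le (hDm α β).abs measurable_const
  refine ⟨hEm, ?_⟩
  have htail : ∀ α β, P.real {ω | K * n * t ≤ |D α β ω|}
      ≤ 2 * Real.exp (-(4 * p ^ 4 * Real.log n)) := by
    intro α β
    refine (measureReal_abs_ge_le_of_hasSubgaussianMGF
      (hasSubgaussianMGF_gramEntry hX hind hunif α β) (by positivity)).trans_eq ?_
    congr 2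
    have ht2 : t ^ 2 = 32 * p ^ 6 * 9 ^ p * Real.log n / (K * n) := Real.sq_sqrt (by positivity)
    rw [mul_pow, ht2]
    push_cast
    field_simp
    ring
  have hcompl : P.real Eᶜ
      ≤ (Fintype.card (MultiIdx n p) : ℝ) ^ 2 * (2 * Real.exp (-(4 * p ^ 4 * Real.log n))) := by
    have hsub : Eᶜ ⊆ ⋃ α, ⋃ β, {ω | K * n * t ≤ |D α β ω|} := by
      intro ω hω
      simp only [hE, Set.mem_compl_iff, Set.mem_ofPred_eq, not_forall, not_le] at hω
      obtain ⟨α, β, h⟩ := hω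
      exact Set.mem_iUnion.2 ⟨α, Set.mem_iUnion.2 ⟨β, by simpa using h.le⟩⟩
    calc P.real Eᶜ ≤ ∑ α, ∑ β, P.real {ω | K * n * t ≤ |D α β ω|} :=
          (measureReal_mono hsub).trans ((measureReal_iUnion_fintype_le _).trans
            (Finset.sum_le_sum fun α _ => measureReal_iUnion_fintype_le _))
      _ ≤ ∑ _α : MultiIdx n p, ∑ _β : MultiIdx n p, 2 * Real.exp (-(4 * p ^ 4 * Real.log n)) :=
          Finset.sum_le_sum fun α _ => Finset.sum_le_sum fun β _ => htail α β
      _ = _ := by simp; ring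
  have hlt := card_sq_mul_exp_lt hn hp
  rw [probReal_compl_eq_one_sub hEm] at hcompl
  rw [probBound]
  linarith

end Probability

/-- The radius of the Gram deviation times an admissible sparsity is at most `√2 / 3 < 12 / 25`. -/
lemma sparsity_mul_sqrt_le {n p K s : ℕ} (hn : 2 ≤ n) (hK : 0 < K)
    (hs : (K : ℝ) ≥ 144 * (p : ℝ) ^ 6 * 9 ^ p * (s : ℝ) ^ 2 * Real.log n / (n : ℝ)) :
    s * Real.sqrt (32 * p ^ 6 * 9 ^ p * Real.log n / (K * n)) ≤ 12 / 25 := by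
  have hn0 : (0 : ℝ) < n := by exact_mod_cast (by omega : 0 < n)
  have hK0 : (0 : ℝ) < K := by exact_mod_cast hK
  have hlog : 0 < Real.log n := Real.log_pos (by exact_mod_cast (by omega : 1 < n))
  rw [ge_iff_le, div_le_iff₀ hn0] at hs
  refine abs_le_of_sq_le_sq' ?_ (by norm_num) |>.2
  rw [mul_pow, Real.sq_sqrt (by positivity), ← mul_div_assoc, div_le_iff₀ (by positivity)]
  have : 0 ≤ (K : ℝ) * n := by positivity
  linarith

/-- Recovery from `K` independent random vectors. -/
theorem exists_event_multiSamplingMatrix {Ω : Type*} [MeasurableSpace Ω] (P : Measure Ω)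
    [IsProbabilityMeasure P] {n p K : ℕ} (hn : 2 ≤ n) (hp : 1 ≤ p) (u : Fin K → Fin n → Ω → ℝ)
    (hu : ∀ k i, Measurable (u k i)) (hind : iIndepFun (fun q : Fin K × Fin n => u q.1 q.2) P)
    (hunif : ∀ k i, pdf.IsUniform (u k i) (Set.Icc (-1 : ℝ) 1) P volume) :
    ∃ E : Set Ω, MeasurableSet E ∧ probBound n p < P.real E ∧ ∀ ω ∈ E, ∀ s : ℕ,
      (K : ℝ) ≥ 144 * (p : ℝ) ^ 6 * 9 ^ p * (s : ℝ) ^ 2 * Real.log n / (n : ℝ) →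
      StableSparseRecovery (multiSamplingMatrix p (fun k i => u k i ω)) s 125 := by
  rcases Nat.eq_zero_or_pos K with rfl | hK
  · -- Without samples only `s = 0` is admissible, and the whole space serves as the event.
    refine ⟨Set.univ, MeasurableSet.univ, ?_, fun ω _ s hs => ?_⟩
    · rw [probReal_univ, probBound, sub_lt_self_iff]
      have hn0 : (0 : ℝ) < n := by exact_mod_cast (by omega : 0 < n)
      have hp0 : (0 : ℝ) < p := by exact_mod_cast hp
      positivity
    · have hs0 : s = 0 := by
        by_contra h
        have hs0 : (0 : ℝ) < s := by exact_mod_cast Nat.pos_of_ne_zero h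
        have hn0 : (0 : ℝ) < n := by exact_mod_cast (by omega : 0 < n)
        have hp0 : (0 : ℝ) < p := by exact_mod_cast hp
        have hlog : 0 < Real.log n := Real.log_pos (by exact_mod_cast (by omega : 1 < n))
        have : 0 < 144 * (p : ℝ) ^ 6 * 9 ^ p * (s : ℝ) ^ 2 * Real.log n / (n : ℝ) := by positivity
        rw [Nat.cast_zero] at hs
        linarith
      exact stableSparseRecovery_of_gramDeviationLE (t := 0) (by simp [hs0])
        (by intro α β; simp) (by norm_num)
  · obtain ⟨hm, hP⟩ := probBound_lt_measureReal (P := P) (X := fun q => u q.1 q.2) hn hp hK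
      (fun q => hu q.1 q.2) hind (fun q => hunif q.1 q.2)
    refine ⟨_, hm, hP, fun ω hω s hs => ?_⟩
    refine stableSparseRecovery_of_gramDeviationLE (fun _ => ⟨⟨0, hK⟩, ⟨0, by omega⟩⟩) ?_
      (sparsity_mul_sqrt_le hn hK hs)
    intro α β
    have := hω α β
    simpa [gramEntry, multiSamplingMatrix, samplingMatrix] using this

end CyclicLegendre

/-! ### Recovery from random samples -/

/-- Recovery of sparse coefficient vectors by basis pursuit with the cyclic Legendre sampling
matrix, from one random vector and from `K` independent random vectors. The constant `d` is
universal; the event `E` is uniform in the sparsity `s`, the vectors `c`, `e` and the level `σ`. -/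
theorem theorem3p3 :
    ∃ d : ℝ, 0 < d ∧
      (∀ (n p : ℕ), 2 ≤ n → 1 ≤ p →
        ∀ (Ω : Type*) [MeasurableSpace Ω] (P : Measure Ω) [IsProbabilityMeasure P]
          (u : Fin n → Ω → ℝ),
          (∀ i, Measurable (u i)) →
          iIndepFun u P →
          (∀ i, pdf.IsUniform (u i) (Set.Icc (-1 : ℝ) 1) P volume) →
          ∃ E : Set Ω, MeasurableSet E ∧ CyclicLegendre.probBound n p < P.real E ∧
            ∀ ω ∈ E, ∀ s : ℕ,
              (n : ℝ) / Real.log n ≥ 144 * (p : ℝ) ^ 6 * 9 ^ p * (s : ℝ) ^ 2 →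
              CyclicLegendre.StableSparseRecovery
                (CyclicLegendre.samplingMatrix p (fun i => u i ω)) s d) ∧
      (∀ (n p K : ℕ), 2 ≤ n → 1 ≤ p →
        ∀ (Ω : Type*) [MeasurableSpace Ω] (P : Measure Ω) [IsProbabilityMeasure P]
          (u : Fin K → Fin n → Ω → ℝ),
          (∀ k i, Measurable (u k i)) →
          iIndepFun (fun q : Fin K × Fin n => u q.1 q.2) P →
          (∀ k i, pdf.IsUniform (u k i) (Set.Icc (-1 : ℝ) 1) P volume) →
          ∃ E : Set Ω, MeasurableSet E ∧ CyclicLegendre.probBound n p < P.real E ∧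
            ∀ ω ∈ E, ∀ s : ℕ,
              (K : ℝ) ≥ 144 * (p : ℝ) ^ 6 * 9 ^ p * (s : ℝ) ^ 2 * Real.log n / (n : ℝ) →
              CyclicLegendre.StableSparseRecovery
                (CyclicLegendre.multiSamplingMatrix p (fun k i => u k i ω)) s d) := by
  refine ⟨125, by norm_num, ?_, ?_⟩
  · intro n p hn hp Ω _ P _ u hu hind hunif
    have hind' : iIndepFun (fun q : Fin 1 × Fin n => u q.2) P :=
      hind.precomp (Equiv.uniqueProd (Fin n) (Fin 1)).injective
    obtain ⟨E, hE, hP, hrec⟩ := CyclicLegendre.exists_event_multiSamplingMatrix P hn hp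
      (fun _ : Fin 1 => u) (fun _ => hu) hind' (fun _ => hunif)
    refine ⟨E, hE, hP, fun ω hω s hs => ?_⟩
    have hn0 : (0 : ℝ) < n := by exact_mod_cast (by omega : 0 < n)
    have hlog : 0 < Real.log n := Real.log_pos (by exact_mod_cast (by omega : 1 < n))
    have hs' : ((1 : ℕ) : ℝ) ≥
        144 * (p : ℝ) ^ 6 * 9 ^ p * (s : ℝ) ^ 2 * Real.log n / (n : ℝ) := by
      rw [ge_iff_le, le_div_iff₀ hlog] at hs
      rw [ge_iff_le, div_le_iff₀ hn0]
      simpa using hs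
    exact (hrec ω hω s hs').submatrix (Equiv.uniqueProd (Fin n) (Fin 1)).symm
  · intro n p K hn hp Ω _ P _ u hu hind hunif
    exact CyclicLegendre.exists_event_multiSamplingMatrix P hn hp u hu hind hunif
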